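/- Let $\mathbb D=\{z\in\mathbb C:|z|<1\}$, and let $f:\mathbb D\to\mathbb C$ be an infinitesimal generator, that is, $f$ is holomorphic and for every $z\in\mathbb D$ the Cauchy problem $\frac{\partial u(t,z)}{\partial t}+f(u(t,z))=0$, $u(0,z)=z$, has a unique solution $u(t,z)\in\mathbb D$ defined for all $t\ge 0$. Suppose that $f(0)=0$ and that $q:=f'(0)$ satisfies $\operatorname{Re} q>0$. Then for every $r>0$ the nonlinear resolvent $G_r=(\mathrm{Id}+rf)^{-1}$ is a well-defined holomorphic self-mapping of $\mathbb D$: for each $w\in\mathbb D$, $G_r(w)$ is the unique $z\in\mathbb D$ with $z+rf(z)=w$. Moreover, the normalized resolvents $(1+rq)G_r(z)$ converge to $z$ as $r\to\infty$, uniformly on compact subsets of $\mathbb D$. -/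

import Mathlib

open Set Filter Topology Metric

/-- The function `u` solves the Cauchy problem `u' + f(u) = 0`, `u(0) = z` for all times `t ≥ 0`
and stays in the open unit disk (at `t = 0` the derivative is the right-hand one). -/
def IsCauchySolution (f : ℂ → ℂ) (z : ℂ) (u : ℝ → ℂ) : Prop :=
  u 0 = z ∧ ∀ t : ℝ, 0 ≤ t →
    u t ∈ ball (0 : ℂ) 1 ∧ HasDerivWithinAt u (-f (u t)) (Ici 0) t

/-- `f` is an infinitesimal generator on the open unit disk: it is holomorphic there, and for
every point `z` of the disk the Cauchy problem has a unique solution in the disk, defined for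
all `t ≥ 0`. -/
def IsGenerator (f : ℂ → ℂ) : Prop :=
  DifferentiableOn ℂ f (ball 0 1) ∧
    ∀ z ∈ ball (0 : ℂ) 1, ∃ u : ℝ → ℂ, IsCauchySolution f z u ∧
      ∀ v : ℝ → ℂ, IsCauchySolution f z v → EqOn v u (Ici 0)

/-- The nonlinear resolvent `G_r = (Id + r f)⁻¹`, the inverse of `Id + r f` restricted to the open
unit disk: its value at `w` is a point `z` of the disk with `z + r f(z) = w`. -/
noncomputable def nonlinearResolvent (f : ℂ → ℂ) (r : ℝ) : ℂ → ℂ :=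
  Function.invFunOn (fun z : ℂ => z + (r : ℂ) * f z) (ball 0 1)

/-- `G` is a holomorphic self-mapping of the open unit disk, and for every `w` in the disk `G w` is
the one and only point `z` of the disk with `z + r f(z) = w`. -/
def IsResolventMap (f : ℂ → ℂ) (r : ℝ) (G : ℂ → ℂ) : Prop :=
  DifferentiableOn ℂ G (ball 0 1) ∧ MapsTo G (ball 0 1) (ball 0 1) ∧
    ∀ w ∈ ball (0 : ℂ) 1, ∀ z ∈ ball (0 : ℂ) 1, z + (r : ℂ) * f z = w ↔ z = G w

/-! The time-`t` maps of the flow are holomorphic self-maps of the disk (`differentiableOn_flow`)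
fixing `0`, so by Schwarz they do not increase `|z|`. Differentiating at `t = 0` gives `Re (conj z *
f z) ≥ 0`, hence `f z = z * p z` with `Re p > 0` by the open mapping theorem
(`IsGenerator.re_dslope_pos`).

Then `F z = z + r f z = z (1 + r p z)` satisfies `|F z| ≥ |z|`, which gives surjectivity onto the
disk by connectedness. Solutions of `F z = w` are fixed points of `z ↦ w / (1 + r p z)`, a map into
a smaller disk; its strict contraction for the pseudo-hyperbolic distance gives uniqueness and `F' ≠
0`, so the inverse is holomorphic.

For the limit, `z = G_r w` satisfies `w - (1 + r p 0) z = r z (p z - p 0)`. Since `z = O(1/r)` and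
`p` is locally Lipschitz, this is `O(1/r)`, uniformly on compacts. -/

open scoped ComplexConjugate

/-! ### Disk automorphisms and fixed points of strict self-maps -/

/-- The automorphism of the unit disk that sends `a` to `0`. -/
noncomputable def diskAut (a z : ℂ) : ℂ := (z - a) / (1 - conj a * z)

theorem diskAut_denom_ne_zero {a z : ℂ} (ha : ‖a‖ < 1) (hz : ‖z‖ < 1) :
    1 - conj a * z ≠ 0 := by
  intro h
  have h1 : ‖conj a * z‖ = 1 := by rw [← sub_eq_zero.1 h]; simp
  rw [norm_mul, RCLike.norm_conj] at h1
  nlinarith [norm_nonneg a, norm_nonneg z]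

theorem norm_diskAut_lt_one {a z : ℂ} (ha : ‖a‖ < 1) (hz : ‖z‖ < 1) : ‖diskAut a z‖ < 1 := by
  rw [diskAut, norm_div, div_lt_one (norm_pos_iff.2 (diskAut_denom_ne_zero ha hz))]
  refine lt_of_pow_lt_pow_left₀ 2 (norm_nonneg _) ?_
  have h1 : ‖a‖ ^ 2 < 1 := by nlinarith [norm_nonneg a]
  have h2 : ‖z‖ ^ 2 < 1 := by nlinarith [norm_nonneg z]
  rw [Complex.sq_norm, Complex.normSq_apply] at *
  rw [Complex.sq_norm, Complex.normSq_apply]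
  simp only [Complex.sub_re, Complex.sub_im, Complex.mul_re, Complex.mul_im, Complex.one_re,
    Complex.one_im, Complex.conj_re, Complex.conj_im]
  -- `|1 - conj a * z|² - |z - a|² = (1 - |a|²)(1 - |z|²)`.
  nlinarith [mul_pos (sub_pos.2 h1) (sub_pos.2 h2)]

theorem diskAut_neg_diskAut {a z : ℂ} (ha : ‖a‖ < 1) (hz : ‖z‖ < 1) :
    diskAut (-a) (diskAut a z) = z := by
  have h1 := diskAut_denom_ne_zero ha hz
  have h2 : diskAut a z * (1 - conj a * z) = z - a := div_mul_cancel₀ _ h1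
  have h3 := diskAut_denom_ne_zero (a := -a) (by simpa using ha) (norm_diskAut_lt_one ha hz)
  rw [diskAut, div_eq_iff h3]
  rw [map_neg]
  linear_combination h2

theorem differentiableOn_diskAut {a : ℂ} (ha : ‖a‖ < 1) :
    DifferentiableOn ℂ (diskAut a) (ball 0 1) := by
  unfold diskAut
  exact DifferentiableOn.div (by fun_prop) (by fun_prop) fun z hz =>
    diskAut_denom_ne_zero ha (by simpa using hz)

/-- A holomorphic map of the unit disk into a smaller closed disk, with a fixed point `a`,
is a strict contraction towards `a` for the pseudo-hyperbolic distance. -/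
theorem exists_norm_diskAut_le_of_mapsTo_closedBall {h : ℂ → ℂ} {s : ℝ} {a : ℂ} (hs : s < 1)
    (hd : DifferentiableOn ℂ h (ball 0 1)) (hm : MapsTo h (ball 0 1) (closedBall 0 s))
    (ha : ‖a‖ < 1) (hfix : h a = a) :
    ∃ c < 1, ∀ z ∈ ball (0 : ℂ) 1, ‖diskAut a (h z)‖ ≤ c * ‖diskAut a z‖ := by
  have hsub : closedBall (0 : ℂ) s ⊆ ball 0 1 := closedBall_subset_ball hs
  have hane : ‖-a‖ < 1 := by simpa using ha
  obtain ⟨y, hy, hmax⟩ := (isCompact_closedBall (0 : ℂ) s).exists_isMaxOn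
    ⟨h a, hm (by simpa using ha)⟩
    ((differentiableOn_diskAut ha).continuousOn.norm.mono hsub)
  have hself : MapsTo (diskAut (-a)) (ball 0 1) (ball 0 1) := fun ζ hζ => by
    simpa using norm_diskAut_lt_one hane (by simpa using hζ)
  refine ⟨‖diskAut a y‖, norm_diskAut_lt_one ha (by simpa using hsub hy), fun z hz => ?_⟩
  have hz' : ‖z‖ < 1 := by simpa using hz
  -- Conjugating moves the fixed point to `0`; the image of `g` lies in a closed disk of radius
  -- `‖diskAut a y‖ < 1`, so the Schwarz lemma gives the factor.
  set g : ℂ → ℂ := fun ζ => diskAut a (h (diskAut (-a) ζ)) with hg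
  have g0 : g 0 = 0 := by simp [hg, diskAut, hfix]
  have hgd : DifferentiableOn ℂ g (ball 0 1) :=
    (differentiableOn_diskAut ha).comp (hd.comp (differentiableOn_diskAut hane) hself)
      fun ζ hζ => hsub (hm (hself hζ))
  have key := Complex.dist_le_div_mul_dist_of_mapsTo_ball (R₂ := ‖diskAut a y‖) hgd
    (fun ζ hζ => by simpa [g0] using hmax (hm (hself hζ)))
    (z := diskAut a z) (by simpa using norm_diskAut_lt_one ha hz')
  rw [g0, dist_zero_right, dist_zero_right, div_one] at key
  simpa [hg, diskAut_neg_diskAut ha hz'] using key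

theorem fixedPoint_unique_of_mapsTo_closedBall {h : ℂ → ℂ} {s : ℝ} {a b : ℂ} (hs : s < 1)
    (hd : DifferentiableOn ℂ h (ball 0 1)) (hm : MapsTo h (ball 0 1) (closedBall 0 s))
    (ha : ‖a‖ < 1) (hfa : h a = a) (hb : ‖b‖ < 1) (hfb : h b = b) : b = a := by
  obtain ⟨c, hc, H⟩ := exists_norm_diskAut_le_of_mapsTo_closedBall hs hd hm ha hfa
  have h1 := H b (by simpa using hb)
  rw [hfb] at h1
  have h2 : diskAut a b = 0 := by
    rw [← norm_le_zero_iff]; nlinarith [norm_nonneg (diskAut a b)]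
  rw [diskAut, div_eq_zero_iff] at h2
  exact sub_eq_zero.1 (h2.resolve_right (diskAut_denom_ne_zero ha hb))

/-- Letting `z → a` in the contraction estimate gives `|h'(a)| ≤ c < 1`. -/
theorem deriv_ne_one_of_mapsTo_closedBall {h : ℂ → ℂ} {s : ℝ} {a : ℂ} (hs : s < 1)
    (hd : DifferentiableOn ℂ h (ball 0 1)) (hm : MapsTo h (ball 0 1) (closedBall 0 s))
    (ha : ‖a‖ < 1) (hfa : h a = a) : deriv h a ≠ 1 := by
  obtain ⟨c, hc, H⟩ := exists_norm_diskAut_le_of_mapsTo_closedBall hs hd hm ha hfa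
  have hmem : ball (0 : ℂ) 1 ∈ 𝓝 a := isOpen_ball.mem_nhds (by simpa using ha)
  have hda := (hd.differentiableAt hmem).hasDerivAt
  have hden := diskAut_denom_ne_zero ha ha
  have hh : Tendsto h (𝓝[≠] a) (𝓝 a) := by
    simpa [hfa] using hda.continuousAt.tendsto.mono_left nhdsWithin_le_nhds
  have hid : Tendsto (fun z : ℂ => z) (𝓝[≠] a) (𝓝 a) := nhdsWithin_le_nhds
  have hlim : Tendsto (fun z => c * ‖(1 - conj a * h z) / (1 - conj a * z)‖) (𝓝[≠] a)
      (𝓝 (c * ‖(1 - conj a * a) / (1 - conj a * a)‖)) :=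
    (((hh.const_mul _).const_sub 1).div ((hid.const_mul _).const_sub 1) hden).norm.const_mul c
  rw [div_self hden, norm_one, mul_one] at hlim
  have hle : ‖deriv h a‖ ≤ c := by
    refine le_of_tendsto_of_tendsto (hasDerivAt_iff_tendsto_slope.1 hda).norm hlim ?_
    filter_upwards [self_mem_nhdsWithin, nhdsWithin_le_nhds hmem] with z hza hz
    have hz' : ‖z‖ < 1 := by simpa using hz
    have hhz : ‖h z‖ < 1 := by simpa using closedBall_subset_ball hs (hm hz)
    have h1 := H z hz
    have p1 := norm_pos_iff.2 (diskAut_denom_ne_zero ha hz')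
    have p2 := norm_pos_iff.2 (diskAut_denom_ne_zero ha hhz)
    have p3 : 0 < ‖z - a‖ := norm_pos_iff.2 (sub_ne_zero.2 hza)
    simp only [diskAut, norm_div] at h1
    rw [slope_def_field, hfa, norm_div, norm_div]
    rw [div_le_iff₀ p2] at h1
    rw [div_le_iff₀ p3]
    refine h1.trans_eq ?_
    ring
  intro h1
  rw [h1, norm_one] at hle
  linarith

/-! ### Dependence of trajectories on the initial value -/

theorem exists_lipschitz_taylor_bounds_of_differentiableOn {f : ℂ → ℂ}
    (hf : DifferentiableOn ℂ f (ball 0 1)) {R : ℝ} (hR : R < 1) :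
    ∃ L M : ℝ, 0 ≤ L ∧ 0 ≤ M ∧ ∀ x ∈ closedBall (0 : ℂ) R, ∀ y ∈ closedBall (0 : ℂ) R,
      ‖f x - f y‖ ≤ L * ‖x - y‖ ∧ ‖f x - f y - deriv f y * (x - y)‖ ≤ M * ‖x - y‖ ^ 2 := by
  have hS : closedBall (0 : ℂ) R ⊆ ball 0 1 := closedBall_subset_ball hR
  have hf' := hf.deriv isOpen_ball
  obtain ⟨L, hL⟩ := (isCompact_closedBall (0 : ℂ) R).exists_bound_of_continuousOn
    (hf'.continuousOn.mono hS)
  obtain ⟨M, hM⟩ := (isCompact_closedBall (0 : ℂ) R).exists_bound_of_continuousOn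
    ((hf'.deriv isOpen_ball).continuousOn.mono hS)
  have hfd : ∀ x ∈ closedBall (0 : ℂ) R, HasDerivAt f (deriv f x) x := fun x hx =>
    (hf.differentiableAt (isOpen_ball.mem_nhds (hS hx))).hasDerivAt
  have hfd' : ∀ x ∈ closedBall (0 : ℂ) R, HasDerivAt (deriv f) (deriv (deriv f) x) x :=
    fun x hx => (hf'.differentiableAt (isOpen_ball.mem_nhds (hS hx))).hasDerivAt
  refine ⟨max L 0, max M 0, le_max_right _ _, le_max_right _ _, fun x hx y hy => ⟨?_, ?_⟩⟩
  · exact (convex_closedBall (0 : ℂ) R).norm_image_sub_le_of_norm_hasDerivWithin_le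
      (fun x hx => (hfd x hx).hasDerivWithinAt) (fun x hx => (hL x hx).trans (le_max_left _ _))
      hy hx
  · have hseg : segment ℝ y x ⊆ closedBall (0 : ℂ) R :=
      (convex_closedBall (0 : ℂ) R).segment_subset hy hx
    have key := (convex_segment (𝕜 := ℝ) y x).norm_image_sub_le_of_norm_hasDerivWithin_le
      (f := fun ζ => f ζ - deriv f y * ζ) (f' := fun ζ => deriv f ζ - deriv f y)
      (C := max M 0 * ‖x - y‖) (x := y) (y := x)
      (fun ζ hζ => by
        have h := ((hfd ζ (hseg hζ)).sub ((hasDerivAt_id ζ).const_mul (deriv f y)))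
        rw [mul_one] at h
        exact h.hasDerivWithinAt)
      (fun ζ hζ => by
        have h := (convex_closedBall (0 : ℂ) R).norm_image_sub_le_of_norm_hasDerivWithin_le
          (fun x hx => (hfd' x hx).hasDerivWithinAt)
          (fun x hx => (hM x hx).trans (le_max_left M 0)) hy (hseg hζ)
        refine h.trans (mul_le_mul_of_nonneg_left ?_ (le_max_right _ _))
        simpa only [dist_eq_norm] using mem_closedBall.1
          ((convex_closedBall y (dist x y)).segment_subset (by simp) (by simp) hζ))
      (left_mem_segment ℝ y x) (right_mem_segment ℝ y x)
    calc _ = ‖f x - deriv f y * x - (f y - deriv f y * y)‖ := by congr 1; ring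
      _ ≤ _ := key.trans_eq (by ring)

theorem IsCauchySolution.continuousOn {f : ℂ → ℂ} {z : ℂ} {u : ℝ → ℂ}
    (hu : IsCauchySolution f z u) : ContinuousOn u (Ici 0) :=
  fun t ht => (hu.2 t ht).2.continuousWithinAt

/-- Trajectories starting close enough to a given trajectory stay close to it. -/
theorem IsCauchySolution.norm_sub_le {f : ℂ → ℂ} {z w : ℂ} {u v : ℝ → ℂ} {R R' L T : ℝ}
    (hR : R ≤ R')
    (hL : ∀ x ∈ closedBall (0 : ℂ) R', ∀ y ∈ closedBall (0 : ℂ) R', ‖f x - f y‖ ≤ L * ‖x - y‖)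
    (hL0 : 0 ≤ L) (hu : IsCauchySolution f z u) (hv : IsCauchySolution f w v)
    (hvR : ∀ t ∈ Icc 0 T, ‖v t‖ ≤ R) (hzw : z ≠ w)
    (hclose : ‖z - w‖ * Real.exp ((L + 1) * T) ≤ R' - R) :
    ∀ t ∈ Icc 0 T, ‖u t - v t‖ ≤ ‖z - w‖ * Real.exp ((L + 1) * t) := by
  have hpos : 0 < ‖z - w‖ := norm_pos_iff.2 (sub_ne_zero.2 hzw)
  -- The rate `L + 1` instead of `L` makes the barrier grow strictly faster than the difference
  -- wherever the two meet.
  have hB : ∀ t : ℝ, HasDerivAt (fun t => ‖z - w‖ * Real.exp ((L + 1) * t))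
      ((L + 1) * (‖z - w‖ * Real.exp ((L + 1) * t))) t := fun t => by
    have h := (((hasDerivAt_id t).const_mul (L + 1)).exp).const_mul ‖z - w‖
    exact h.congr_deriv (by simp only [id]; ring)
  refine image_norm_le_of_norm_deriv_right_lt_deriv_boundary'
    (f' := fun t => -f (u t) - -f (v t))
    ((hu.continuousOn.sub hv.continuousOn).mono Icc_subset_Ici_self)
    (fun t ht => ((hu.2 t ht.1).2.sub (hv.2 t ht.1).2).mono (Ici_subset_Ici.2 ht.1))
    (by simp [hu.1, hv.1]) (fun t _ => (hB t).continuousAt.continuousWithinAt)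
    (fun t _ => (hB t).hasDerivWithinAt) fun t ht heq => ?_
  rw [Pi.sub_apply] at heq
  have ht' := Ico_subset_Icc_self ht
  have h1 : ‖u t - v t‖ ≤ R' - R := by
    rw [heq]
    refine le_trans ?_ hclose
    gcongr
    exact ht'.2
  have h2 : ‖u t‖ ≤ R' := by
    calc ‖u t‖ = ‖(u t - v t) + v t‖ := by rw [sub_add_cancel]
      _ ≤ (R' - R) + R := (norm_add_le _ _).trans (add_le_add h1 (hvR t ht'))
      _ = R' := by ring
  have h3 := hL (v t) (by simpa using (hvR t ht').trans hR) (u t) (by simpa using h2)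
  have h4 : -f (u t) - -f (v t) = f (v t) - f (u t) := by ring
  rw [h4]
  rw [norm_sub_rev (v t), heq] at h3
  have : 0 < ‖z - w‖ * Real.exp ((L + 1) * t) := by positivity
  nlinarith

/-- The flow of a holomorphic vector field on the disk is holomorphic in the initial value. -/
theorem differentiableOn_flow {f : ℂ → ℂ} (hf : DifferentiableOn ℂ f (ball 0 1))
    {U : ℂ → ℝ → ℂ} (hU : ∀ z ∈ ball (0 : ℂ) 1, IsCauchySolution f z (U z)) {T : ℝ}
    (hT : 0 ≤ T) : DifferentiableOn ℂ (fun z => U z T) (ball 0 1) := by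
  intro w hw
  refine DifferentiableAt.differentiableWithinAt ?_
  have hγ := hU w hw
  have hγc : ContinuousOn (U w) (Icc 0 T) := hγ.continuousOn.mono Icc_subset_Ici_self
  obtain ⟨R, ⟨hR0, hR1⟩, hR⟩ := exists_pos_lt_subset_ball one_pos
    (isCompact_Icc.image_of_continuousOn hγc).isClosed
    (image_subset_iff.2 fun t ht => (hγ.2 t ht.1).1)
  have hγR : ∀ t ∈ Icc 0 T, ‖U w t‖ ≤ R := fun t ht => by
    simpa using (ball_subset_closedBall (hR (mem_image_of_mem _ ht)))
  set R' := (1 + R) / 2 with hR'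
  have hRR' : R < R' := by linarith
  obtain ⟨L, M, hL0, hM0, hLM⟩ := exists_lipschitz_taylor_bounds_of_differentiableOn hf
    (show R' < 1 by linarith)
  set E := Real.exp ((L + 1) * T) with hE
  -- Freezing the trajectory for `t < 0` makes `k` continuous on all of `ℝ`.
  let k : ℝ → ℂ := fun t => deriv f (U w (max t 0))
  have hk : Continuous k := by
    have h1 : Continuous fun t : ℝ => U w (max t 0) :=
      hγ.continuousOn.comp_continuous (by fun_prop) fun t => mem_Ici.2 (le_max_right _ _)
    exact (hf.deriv isOpen_ball).continuousOn.comp_continuous h1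
      fun t => (hγ.2 _ (le_max_right _ _)).1
  -- Integrating factor of the linearized equation `v' = -k v`: it cancels the first-order term, so
  -- `A t * (U z t - U w t)` is constant up to `O(|z - w|²)`.
  let A : ℝ → ℂ := fun t => Complex.exp (∫ s in (0 : ℝ)..t, k s)
  have hA : ∀ t, HasDerivAt A (A t * k t) t := fun t =>
    ((hk.integral_hasStrictDerivAt 0 t).hasDerivAt).cexp
  have hAc : Continuous A := continuous_iff_continuousAt.2 fun t => (hA t).continuousAt
  obtain ⟨C, hC⟩ := (isCompact_Icc (a := (0 : ℝ)) (b := T)).exists_bound_of_continuousOn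
    hAc.continuousOn
  have hC0 : 0 ≤ C := (norm_nonneg _).trans (hC 0 ⟨le_rfl, hT⟩)
  have hmain : ∀ᶠ z in 𝓝 w, ‖A T * (U z T - U w T) - (z - w)‖ ≤
      (C * (M * E ^ 2) * T) * ‖(z - w) ^ 2‖ := by
    have hev : ∀ᶠ z in 𝓝 w, ‖z - w‖ * E < R' - R := by
      have : Tendsto (fun z : ℂ => ‖z - w‖ * E) (𝓝 w) (𝓝 (‖w - w‖ * E)) :=
        Continuous.tendsto (by fun_prop) w
      refine this.eventually_lt_const ?_
      simp only [sub_self, norm_zero, zero_mul]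
      linarith
    filter_upwards [hev, isOpen_ball.mem_nhds hw] with z hz hzb
    rcases eq_or_ne z w with rfl | hzw
    · simp
    have hu := hU z hzb
    have hclose := IsCauchySolution.norm_sub_le hRR'.le (fun x hx y hy => (hLM x hx y hy).1)
      hL0 hu hγ hγR hzw hz.le
    have hd : ∀ t ∈ Icc 0 T, ‖U z t - U w t‖ ≤ ‖z - w‖ * E := fun t ht => by
      refine (hclose t ht).trans ?_
      rw [hE]
      gcongr
      exact ht.2
    have key := norm_image_sub_le_of_norm_deriv_right_le_segment (a := 0) (b := T)
      (f := fun t => A t * (U z t - U w t))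
      (f' := fun t => A t * k t * (U z t - U w t) + A t * (-f (U z t) - -f (U w t)))
      (C := C * (M * (‖z - w‖ * E) ^ 2))
      (hAc.continuousOn.mul (((hu.continuousOn.sub hγ.continuousOn)).mono Icc_subset_Ici_self))
      (fun t ht => (hA t).hasDerivWithinAt.mul
        (((hu.2 t ht.1).2.sub (hγ.2 t ht.1).2).mono (Ici_subset_Ici.2 ht.1)))
      (fun t ht => by
        have ht' := Ico_subset_Icc_self ht
        have hkt : k t = deriv f (U w t) := by simp only [k, max_eq_left ht.1]
        have hut : ‖U z t‖ ≤ R' := by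
          calc ‖U z t‖ = ‖(U z t - U w t) + U w t‖ := by rw [sub_add_cancel]
            _ ≤ (R' - R) + R :=
              (norm_add_le _ _).trans (add_le_add ((hd t ht').trans hz.le) (hγR t ht'))
            _ = R' := by ring
        have hq := (hLM (U z t) (by simpa using hut) (U w t)
          (by simpa using (hγR t ht').trans hRR'.le)).2
        have heq : A t * k t * (U z t - U w t) + A t * (-f (U z t) - -f (U w t)) =
            -(A t * (f (U z t) - f (U w t) - deriv f (U w t) * (U z t - U w t))) := by
          rw [hkt]; ring
        rw [heq, norm_neg, norm_mul]
        gcongr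
        · exact hC t ht'
        · refine hq.trans ?_
          gcongr
          exact hd t ht')
      T ⟨hT, le_rfl⟩
    have hA0 : A 0 = 1 := by simp [A]
    rw [hA0, hu.1, hγ.1, one_mul, sub_zero] at key
    rw [norm_pow]
    refine key.trans_eq ?_
    ring
  have hder : HasDerivAt (fun z => A T * (U z T - U w T)) 1 w := by
    rw [hasDerivAt_iff_isLittleO]
    refine (Asymptotics.IsBigO.of_bound (C * (M * E ^ 2) * T) ?_).trans_isLittleO
      (Asymptotics.isLittleO_pow_sub_sub w (m := 2) one_lt_two)
    filter_upwards [hmain] with z hz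
    simpa using hz
  have hfin := (hder.const_mul (A T)⁻¹).add_const (U w T)
  refine hfin.differentiableAt.congr_of_eventuallyEq (Eventually.of_forall fun z => ?_)
  have : A T ≠ 0 := Complex.exp_ne_zero _
  field_simp
  ring

/-! ### Generators vanishing at the origin -/

/-- A generator on the disk that vanishes at the origin points outwards on centred circles. -/
theorem IsGenerator.re_conj_mul_nonneg {f : ℂ → ℂ} (hf : IsGenerator f) (hf0 : f 0 = 0) {z : ℂ}
    (hz : z ∈ ball (0 : ℂ) 1) : 0 ≤ (conj z * f z).re := by
  obtain ⟨hd, hex⟩ := hf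
  choose! U hU huniq using hex
  have h0 : (0 : ℂ) ∈ ball (0 : ℂ) 1 := by simp
  have hU0 : ∀ t, 0 ≤ t → U 0 t = 0 := fun t ht => by
    have : IsCauchySolution f 0 fun _ => 0 :=
      ⟨rfl, fun t _ => ⟨h0, by simpa [hf0] using hasDerivWithinAt_const t (Ici 0) (0 : ℂ)⟩⟩
    exact (huniq 0 h0 _ this ht).symm
  -- Schwarz lemma for the time-`t` map; hence `|U z t|²` has nonpositive right derivative at `0`.
  have hle : ∀ t, 0 ≤ t → ‖U z t‖ ≤ ‖z‖ := fun t ht =>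
    Complex.norm_le_norm_of_mapsTo_ball (differentiableOn_flow hd hU ht)
      (fun w hw => ball_subset_closedBall ((hU w hw).2 t ht).1) (hU0 t ht) (by simpa using hz)
  have hder := ((hU z hz).2 0 le_rfl).2
  rw [(hU z hz).1] at hder
  have hder2 := hder.norm_sq
  rw [(hU z hz).1] at hder2
  rw [hasDerivWithinAt_iff_tendsto_slope] at hder2
  rw [Ici_sdiff_left] at hder2
  have hlim := le_of_tendsto hder2 (b := 0) (by
    filter_upwards [self_mem_nhdsWithin] with t ht
    have ht' : (0 : ℝ) < t := ht
    rw [slope_def_field, (hU z hz).1, sub_zero]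
    have := hle t ht'.le
    exact div_nonpos_of_nonpos_of_nonneg
      (sub_nonpos.2 (pow_le_pow_left₀ (norm_nonneg _) this 2)) ht'.le)
  have e : inner ℝ z (-f z) = -(conj z * f z).re := by
    rw [Complex.inner]; simp [mul_comm]
  rw [e] at hlim
  linarith

theorem dslope_zero_mul_self {f : ℂ → ℂ} (hf0 : f 0 = 0) (z : ℂ) : z * dslope f 0 z = f z := by
  simpa [hf0] using sub_smul_dslope f 0 z

theorem IsGenerator.differentiableOn_dslope {f : ℂ → ℂ} (hf : IsGenerator f) :
    DifferentiableOn ℂ (dslope f 0) (ball 0 1) :=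
  (Complex.differentiableOn_dslope (ball_mem_nhds _ one_pos)).2 hf.1

/-- If a generator vanishes at the origin with derivative of positive real part, then
`f z = z * p z` with `p` of positive real part on the disk. -/
theorem IsGenerator.re_dslope_pos {f : ℂ → ℂ} (hf : IsGenerator f) (hf0 : f 0 = 0)
    (hq : 0 < (deriv f 0).re) {z : ℂ} (hz : z ∈ ball (0 : ℂ) 1) : 0 < (dslope f 0 z).re := by
  have h0 : (0 : ℂ) ∈ ball (0 : ℂ) 1 := by simp
  have hq' : 0 < (dslope f 0 0).re := by simpa using hq
  have hnn : ∀ z ∈ ball (0 : ℂ) 1, 0 ≤ (dslope f 0 z).re := fun z hz => by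
    rcases eq_or_ne z 0 with rfl | hne
    · exact hq'.le
    have h := hf.re_conj_mul_nonneg hf0 hz
    rw [← dslope_zero_mul_self hf0 z, ← mul_assoc, mul_comm (conj z), Complex.mul_conj,
      Complex.re_ofReal_mul] at h
    exact nonneg_of_mul_nonneg_right h (Complex.normSq_pos.2 hne)
  -- A nonconstant quotient has open image, which cannot touch the boundary of the half-plane.
  rcases (hf.differentiableOn_dslope.analyticOnNhd isOpen_ball).is_constant_or_isOpen
    (convex_ball (0 : ℂ) 1).isPreconnected with ⟨c, hc⟩ | hopen
  · rw [hc z hz, ← hc 0 h0]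
    exact hq'
  · have him := hopen _ Subset.rfl isOpen_ball
    have hsub : dslope f 0 '' ball 0 1 ⊆ {ζ : ℂ | 0 ≤ ζ.re} := image_subset_iff.2 hnn
    have := interior_maximal hsub him (mem_image_of_mem _ hz)
    rwa [Complex.interior_setOfPred_le_re] at this

/-! ### Existence, uniqueness and holomorphy of the resolvent -/

section Resolvent

variable {f p : ℂ → ℂ} {r : ℝ}

theorem one_le_norm_one_add_mul {ζ : ℂ} (hr : 0 < r) (hζ : 0 < ζ.re) : 1 ≤ ‖1 + (r : ℂ) * ζ‖ := by
  refine le_trans ?_ (Complex.re_le_norm _)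
  rw [Complex.add_re, Complex.re_ofReal_mul, Complex.one_re]
  nlinarith [mul_pos hr hζ]

theorem one_add_mul_ne_zero {ζ : ℂ} (hr : 0 < r) (hζ : 0 < ζ.re) : 1 + (r : ℂ) * ζ ≠ 0 :=
  norm_pos_iff.1 (one_pos.trans_le (one_le_norm_one_add_mul hr hζ))

theorem norm_le_norm_add_mul (hfp : ∀ z, f z = z * p z) (hp : ∀ z ∈ ball (0 : ℂ) 1, 0 < (p z).re)
    (hr : 0 < r) {z : ℂ} (hz : z ∈ ball (0 : ℂ) 1) : ‖z‖ ≤ ‖z + (r : ℂ) * f z‖ := by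
  have h : z + (r : ℂ) * f z = z * (1 + (r : ℂ) * p z) := by rw [hfp]; ring
  rw [h, norm_mul]
  exact le_mul_of_one_le_right (norm_nonneg _) (one_le_norm_one_add_mul hr (hp z hz))

/-- The equation `z + r f(z) = w` is the fixed point equation of a holomorphic map of the disk
into the closed disk of radius `‖w‖`. -/
theorem resolvent_fixedPoint_map (hpd : DifferentiableOn ℂ p (ball 0 1))
    (hp : ∀ z ∈ ball (0 : ℂ) 1, 0 < (p z).re) (hr : 0 < r) (w : ℂ) :
    DifferentiableOn ℂ (fun z => w / (1 + (r : ℂ) * p z)) (ball 0 1) ∧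
      MapsTo (fun z => w / (1 + (r : ℂ) * p z)) (ball 0 1) (closedBall 0 ‖w‖) := by
  refine ⟨DifferentiableOn.div (by fun_prop) ((hpd.const_mul _).const_add _) fun z hz =>
    one_add_mul_ne_zero hr (hp z hz), fun z hz => ?_⟩
  rw [mem_closedBall_zero_iff, norm_div]
  exact div_le_self (norm_nonneg _) (one_le_norm_one_add_mul hr (hp z hz))

theorem resolvent_eq_iff (hfp : ∀ z, f z = z * p z) (hp : ∀ z ∈ ball (0 : ℂ) 1, 0 < (p z).re)
    (hr : 0 < r) (w : ℂ) {z : ℂ} (hz : z ∈ ball (0 : ℂ) 1) :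
    z + (r : ℂ) * f z = w ↔ w / (1 + (r : ℂ) * p z) = z := by
  rw [div_eq_iff (one_add_mul_ne_zero hr (hp z hz)), hfp, eq_comm]
  ring_nf

theorem resolvent_unique (hfp : ∀ z, f z = z * p z) (hpd : DifferentiableOn ℂ p (ball 0 1))
    (hp : ∀ z ∈ ball (0 : ℂ) 1, 0 < (p z).re) (hr : 0 < r) {w : ℂ} (hw : w ∈ ball (0 : ℂ) 1)
    {a b : ℂ} (ha : a ∈ ball (0 : ℂ) 1) (hb : b ∈ ball (0 : ℂ) 1)
    (hfa : a + (r : ℂ) * f a = w) (hfb : b + (r : ℂ) * f b = w) : b = a := by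
  obtain ⟨hd, hm⟩ := resolvent_fixedPoint_map hpd hp hr w
  exact fixedPoint_unique_of_mapsTo_closedBall (by simpa using hw) hd hm (by simpa using ha)
    ((resolvent_eq_iff hfp hp hr w ha).1 hfa) (by simpa using hb)
    ((resolvent_eq_iff hfp hp hr w hb).1 hfb)

/-- With `w = F a`, the map `h z = w / (1 + r p z)` has `h'(a) = -r a p'(a) / (1 + r p a)`, while
`F'(a) = 1 + r p a + r a p'(a)`. Thus `F'(a) = 0` would force `h'(a) = 1`. -/
theorem resolvent_deriv_ne_zero (hfp : ∀ z, f z = z * p z)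
    (hpd : DifferentiableOn ℂ p (ball 0 1)) (hp : ∀ z ∈ ball (0 : ℂ) 1, 0 < (p z).re)
    (hr : 0 < r) {a : ℂ} (ha : a ∈ ball (0 : ℂ) 1) (hw : a + (r : ℂ) * f a ∈ ball (0 : ℂ) 1) :
    deriv (fun z => z + (r : ℂ) * f z) a ≠ 0 := by
  have hmem := isOpen_ball.mem_nhds ha
  have hpa := (hpd.differentiableAt hmem).hasDerivAt
  have hP := (hpa.const_mul (r : ℂ)).const_add 1
  have hF : HasDerivAt (fun z => z + (r : ℂ) * f z)
      (1 * (1 + (r : ℂ) * p a) + a * ((r : ℂ) * deriv p a)) a := by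
    refine ((hasDerivAt_id a).mul hP).congr_of_eventuallyEq (Eventually.of_forall fun z => ?_)
    simp only [hfp, id, Pi.mul_apply]
    ring
  have hne := one_add_mul_ne_zero hr (hp a ha)
  obtain ⟨hd, hm⟩ := resolvent_fixedPoint_map hpd hp hr (a + (r : ℂ) * f a)
  have hfix := (resolvent_eq_iff hfp hp hr _ ha).1 rfl
  have h1 := deriv_ne_one_of_mapsTo_closedBall (by simpa using hw) hd hm (by simpa using ha) hfix
  have h2 := ((hasDerivAt_const a (a + (r : ℂ) * f a)).div hP hne).deriv
  rw [hF.deriv]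
  intro h3
  refine h1 (h2.trans ?_)
  rw [div_eq_one_iff_eq (pow_ne_zero 2 hne), hfp]
  linear_combination (-(1 + (r : ℂ) * p a)) * h3

theorem resolvent_isOpen_image (hfp : ∀ z, f z = z * p z) (hfd : DifferentiableOn ℂ f (ball 0 1))
    (hp : ∀ z ∈ ball (0 : ℂ) 1, 0 < (p z).re) (hr : 0 < r) :
    ∀ s ⊆ ball (0 : ℂ) 1, IsOpen s → IsOpen ((fun z => z + (r : ℂ) * f z) '' s) := by
  refine ((DifferentiableOn.analyticOnNhd (f := fun z => z + (r : ℂ) * f z)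
    (differentiableOn_id.add (hfd.const_mul _)) isOpen_ball).is_constant_or_isOpen
    (convex_ball (0 : ℂ) 1).isPreconnected).resolve_left ?_
  rintro ⟨c, hc⟩
  have h0 := hc 0 (by simp)
  have hh : (1 / 2 : ℂ) ∈ ball (0 : ℂ) 1 := by
    rw [mem_ball_zero_iff]; norm_num
  have h1 := norm_le_norm_add_mul hfp hp hr hh
  have h2 := hc _ hh
  rw [h2, ← h0, hfp] at h1
  norm_num at h1

/-- The image is open, and relatively closed in the disk because `|F z| ≥ |z|` confines preimages of
a smaller disk to a compact set. -/
theorem resolvent_exists (hfp : ∀ z, f z = z * p z) (hfd : DifferentiableOn ℂ f (ball 0 1))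
    (hp : ∀ z ∈ ball (0 : ℂ) 1, 0 < (p z).re) (hr : 0 < r) :
    ball (0 : ℂ) 1 ⊆ (fun z => z + (r : ℂ) * f z) '' ball 0 1 := by
  have hopen := resolvent_isOpen_image hfp hfd hp hr _ Subset.rfl isOpen_ball
  have hFc : ContinuousOn (fun z => z + (r : ℂ) * f z) (ball 0 1) :=
    continuousOn_id.add (continuousOn_const.mul hfd.continuousOn)
  refine (convex_ball (0 : ℂ) 1).isPreconnected.subset_of_closure_inter_subset hopen
    ⟨0, by simp, 0, by simp, by simp [hfp]⟩ ?_
  rintro w ⟨hwc, hw⟩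
  rw [mem_ball_zero_iff] at hw
  obtain ⟨s, hws, hs1⟩ := exists_between hw
  have hcs : closedBall (0 : ℂ) s ⊆ ball 0 1 := closedBall_subset_ball hs1
  have hclosed : IsClosed ((fun z => z + (r : ℂ) * f z) '' closedBall 0 s) :=
    ((isCompact_closedBall (0 : ℂ) s).image_of_continuousOn (hFc.mono hcs)).isClosed
  have hmem : w ∈ closure (ball (0 : ℂ) s ∩ (fun z => z + (r : ℂ) * f z) '' ball 0 1) :=
    isOpen_ball.inter_closure ⟨by simpa using hws, hwc⟩
  refine image_mono hcs (closure_minimal ?_ hclosed hmem)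
  rintro _ ⟨h1, z, hz, rfl⟩
  refine mem_image_of_mem _ ?_
  rw [mem_closedBall_zero_iff]
  exact (norm_le_norm_add_mul hfp hp hr hz).trans (by simpa using (mem_ball_zero_iff.1 h1).le)

theorem isResolventMap_nonlinearResolvent (hfp : ∀ z, f z = z * p z)
    (hpd : DifferentiableOn ℂ p (ball 0 1)) (hp : ∀ z ∈ ball (0 : ℂ) 1, 0 < (p z).re)
    (hr : 0 < r) : IsResolventMap f r (nonlinearResolvent f r) := by
  have hfd : DifferentiableOn ℂ f (ball 0 1) :=
    (differentiableOn_id.mul hpd).congr fun z _ => hfp z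
  have hex := resolvent_exists hfp hfd hp hr
  have hGmem : MapsTo (nonlinearResolvent f r) (ball 0 1) (ball 0 1) := fun w hw =>
    Function.invFunOn_mem (hex hw)
  have hGeq : ∀ w ∈ ball (0 : ℂ) 1,
      nonlinearResolvent f r w + (r : ℂ) * f (nonlinearResolvent f r w) = w := fun w hw =>
    Function.invFunOn_eq (f := fun z : ℂ => z + (r : ℂ) * f z) (hex hw)
  have hiff : ∀ w ∈ ball (0 : ℂ) 1, ∀ z ∈ ball (0 : ℂ) 1,
      z + (r : ℂ) * f z = w ↔ z = nonlinearResolvent f r w := fun w hw z hz =>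
    ⟨fun h => resolvent_unique hfp hpd hp hr hw (hGmem hw) hz (hGeq w hw) h,
      fun h => h ▸ hGeq w hw⟩
  refine ⟨fun w hw => ?_, hGmem, hiff⟩
  -- Continuity of the inverse comes from openness of `F` together with uniqueness of preimages.
  have hcont : ContinuousAt (nonlinearResolvent f r) w := by
    intro V hV
    obtain ⟨W, hWV, hWo, hwW⟩ := _root_.mem_nhds_iff.1
      (inter_mem hV (isOpen_ball.mem_nhds (hGmem hw)))
    have himg := resolvent_isOpen_image hfp hfd hp hr W (fun z hz => (hWV hz).2) hWo
    have hwi : w ∈ (fun z => z + (r : ℂ) * f z) '' W := ⟨_, hwW, hGeq w hw⟩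
    rw [mem_map]
    filter_upwards [himg.mem_nhds hwi, isOpen_ball.mem_nhds hw] with y hy hyb
    obtain ⟨z, hz, hzy⟩ := hy
    rw [mem_preimage, ← (hiff y hyb z (hWV hz).2).1 hzy]
    exact (hWV hz).1
  have hFd : DifferentiableAt ℂ (fun z => z + (r : ℂ) * f z) (nonlinearResolvent f r w) :=
    differentiableAt_id.add
      ((hfd.differentiableAt (isOpen_ball.mem_nhds (hGmem hw))).const_mul _)
  refine (HasDerivAt.of_local_left_inverse hcont hFd.hasDerivAt
    (resolvent_deriv_ne_zero hfp hpd hp hr (hGmem hw) (by rwa [hGeq w hw])) ?_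
    ).differentiableAt.differentiableWithinAt
  filter_upwards [isOpen_ball.mem_nhds hw] with y hy using hGeq y hy

/-! ### Asymptotics of the normalized resolvents -/

theorem tendstoUniformlyOn_normalized_resolvent {G : ℝ → ℂ → ℂ} (hfp : ∀ z, f z = z * p z)
    (hpd : DifferentiableOn ℂ p (ball 0 1)) (hp : ∀ z ∈ ball (0 : ℂ) 1, 0 < (p z).re)
    (hG : ∀ r, 0 < r → IsResolventMap f r (G r)) {K : Set ℂ} (hK : IsCompact K)
    (hKb : K ⊆ ball 0 1) :
    TendstoUniformlyOn (fun (r : ℝ) (z : ℂ) => (1 + (r : ℂ) * p 0) * G r z) (fun z => z)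
      atTop K := by
  obtain ⟨s, ⟨hs0, hs1⟩, hKs⟩ := exists_pos_lt_subset_ball one_pos hK.isClosed hKb
  have hsub : closedBall (0 : ℂ) s ⊆ ball 0 1 := closedBall_subset_ball hs1
  have h0s : (0 : ℂ) ∈ closedBall (0 : ℂ) s := mem_closedBall_self hs0.le
  -- As `|G r w| ≤ |w|`, all the resolvents map `K` into this one compact disk, so `m` and `L` serve
  -- for every `r`.
  obtain ⟨y, hy, hmin⟩ := (isCompact_closedBall (0 : ℂ) s).exists_isMinOn ⟨0, h0s⟩
    (Complex.continuous_re.comp_continuousOn (hpd.continuousOn.mono hsub))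
  set m := (p y).re with hm
  have hm0 : 0 < m := hp y (hsub hy)
  obtain ⟨L, _, hL0, _, hL⟩ := exists_lipschitz_taylor_bounds_of_differentiableOn hpd hs1
  have hbound : ∀ r : ℝ, 0 < r → ∀ w ∈ K,
      ‖w - (1 + (r : ℂ) * p 0) * G r w‖ ≤ (L / m ^ 2) * r⁻¹ := by
    intro r hr w hw
    obtain ⟨-, hmaps, hiff⟩ := hG r hr
    have hwb := hKb hw
    have hzb := hmaps hwb
    have hzeq := (hiff w hwb _ hzb).2 rfl
    set z := G r w
    have hzw : ‖z‖ ≤ ‖w‖ := by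
      have := norm_le_norm_add_mul hfp hp hr hzb
      rwa [hzeq] at this
    have hzs : z ∈ closedBall (0 : ℂ) s := by
      rw [mem_closedBall_zero_iff]
      exact hzw.trans (mem_ball_zero_iff.1 (hKs hw)).le
    have hre : m ≤ (p z).re := hmin hzs
    have hfac : z * (1 + (r : ℂ) * p z) = w := by rw [← hzeq, hfp]; ring
    have hden : r * m ≤ ‖1 + (r : ℂ) * p z‖ := by
      refine le_trans ?_ (Complex.re_le_norm _)
      rw [Complex.add_re, Complex.re_ofReal_mul, Complex.one_re]
      nlinarith
    have hrm : 0 < r * m := mul_pos hr hm0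
    have hz1 : ‖z‖ ≤ 1 / (r * m) := by
      rw [le_div_iff₀ hrm]
      calc ‖z‖ * (r * m) ≤ ‖z‖ * ‖1 + (r : ℂ) * p z‖ := by gcongr
        _ = ‖w‖ := by rw [← norm_mul, hfac]
        _ ≤ 1 := (mem_ball_zero_iff.1 hwb).le
    have hdiff : w - (1 + (r : ℂ) * p 0) * z = (r : ℂ) * (z * (p z - p 0)) := by
      rw [← hfac]; ring
    have hLz := (hL z hzs 0 h0s).1
    rw [sub_zero] at hLz
    rw [hdiff, norm_mul, norm_mul, Complex.norm_real, Real.norm_of_nonneg hr.le]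
    calc r * (‖z‖ * ‖p z - p 0‖) ≤ r * (1 / (r * m) * (L * (1 / (r * m)))) := by
          gcongr
          exact hLz.trans (by gcongr)
      _ = (L / m ^ 2) * r⁻¹ := by field_simp
  rw [Metric.tendstoUniformlyOn_iff]
  intro ε hε
  have hlim : Tendsto (fun r : ℝ => (L / m ^ 2) * r⁻¹) atTop (𝓝 0) := by
    simpa using tendsto_inv_atTop_zero.const_mul (L / m ^ 2)
  filter_upwards [hlim.eventually_lt_const hε, eventually_gt_atTop 0] with r hrε hr w hw
  rw [dist_eq_norm]
  exact (hbound r hr w hw).trans_lt hrε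

end Resolvent

theorem mainTheorem8 (f : ℂ → ℂ) (q : ℂ) (hf : IsGenerator f) (hf0 : f 0 = 0)
    (hfq : deriv f 0 = q) (hq : 0 < q.re) :
    (∀ r : ℝ, 0 < r → IsResolventMap f r (nonlinearResolvent f r)) ∧
    ∀ K : Set ℂ, IsCompact K → K ⊆ ball 0 1 →
      TendstoUniformlyOn (fun (r : ℝ) (z : ℂ) => (1 + (r : ℂ) * q) * nonlinearResolvent f r z)
        (fun z => z) atTop K := by
  have hfp : ∀ z, f z = z * dslope f 0 z := fun z => (dslope_zero_mul_self hf0 z).symm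
  have hpd := hf.differentiableOn_dslope
  have hp : ∀ z ∈ ball (0 : ℂ) 1, 0 < (dslope f 0 z).re := fun z hz =>
    hf.re_dslope_pos hf0 (by rwa [hfq]) hz
  have hres : ∀ r : ℝ, 0 < r → IsResolventMap f r (nonlinearResolvent f r) := fun r hr =>
    isResolventMap_nonlinearResolvent hfp hpd hp hr
  refine ⟨hres, fun K hK hKb => ?_⟩
  have h := tendstoUniformlyOn_normalized_resolvent hfp hpd hp hres hK hKb
  rwa [dslope_same, hfq] at h
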